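/- Let $K$ be a field with nine elements, let $\zeta\in K$ satisfy $\zeta^2=1-\zeta$ (so $\zeta$ is a primitive element of $K$), and let $v\neq w$ be two points outside $\mathbb{P}^1(K)=K\cup\{\infty\}$. Write $[x,y]=xyx^{-1}y^{-1}$ and $x^y=y^{-1}xy$; permutations are composed as maps (right factor first). Let $\mathrm{M}(3^2)$ be the group of all permutations $\omega\mapsto\frac{p\,\theta(\omega)+q}{r\,\theta(\omega)+s}$ of $\mathbb{P}^1(K)$ with $p,q,r,s\in K$ and $\Delta=ps-qr\neq0$, where $\theta$ is the identity if $\Delta$ is a square in $K$, and $\theta(\omega)=\omega^3$ $(\omega\in K)$, $\theta(\infty)=\infty$ otherwise; let it act on the twelve points $K\cup\{\infty,v,w\}$ fixing $v$ and $w$. Let $S_4$ and $S_5$ be the permutations of these twelve points such that $S_4$ interchanges $\infty$ and $v$, fixes $w$, and maps $\alpha+\zeta\beta\mapsto\alpha-\zeta\beta$ for $\alpha,\beta$ in the prime field of $K$, while $S_5$ interchanges $v$ and $w$, fixes $\infty$, and maps $\omega\mapsto\omega^3$ for $\omega\in K$. Let $M_{11}=\langle \mathrm{M}(3^2),S_4\rangle$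 and $M_{12}=\langle M_{11},S_5\rangle$ (Witt's construction of the Mathieu groups). **Proposition.** The group $M_{12}$ is generated by the permutations $$a:\omega\mapsto\zeta^{-1}\omega^3,\qquad T:\omega\mapsto1-\omega,\qquad J:\omega\mapsto\omega^{-1},\qquad U=S_4,\qquad V=S_5$$ (where $a$ and $T$ fix $\infty$, $J$ interchanges $0$ and $\infty$, and $a,T,J$ fix $v$ and $w$), and in these generators it has the defining relations $$T^2=J^2=(JT)^3=(Ta^2)^3=[J,a]^4=(J[J,a])^2=1,\quad a^2=[J,a]^2,\quad (aT)^2=T^{[J,a]},$$ $$U^2=(UT)^2=(UJ)^3=1,\quad a^U=[J,a],$$ $$V^2=(VT)^2=(VJ)^2=(VU)^3=1,\quad a^V=[J,a]^{-1}a,\quad [J,a]^V=[J,a]^{-1}.$$ That is, the abstract group presented by the symbols $a,T,J,U,V$ and these relations is isomorphic to $M_{12}$ via the map sending each symbol to the permutation of the same name. -/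

import Mathlib

open OnePoint

namespace Mathieu

/-! ### The group `M(3²)` on the projective line over a field `K` with nine elements -/

/-- The permutation of the projective line `OnePoint K = K ∪ {∞}` that fixes `∞` and acts on `K`
as `e`. -/
def affinePerm {K : Type*} (e : Equiv.Perm K) : Equiv.Perm (OnePoint K) where
  toFun := OnePoint.map e
  invFun := OnePoint.map e.symm
  left_inv p := by cases p <;> simp
  right_inv p := by cases p <;> simp

/-- The cubing map `ω ↦ ω ^ 3` on a field with nine elements. -/
def cubePerm {K : Type*} [Field K] (hK : Nat.card K = 9) : Equiv.Perm K :=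
  Function.Involutive.toPerm (fun x => x ^ 3) (by
    intro x
    have : Finite K := Nat.finite_of_card_ne_zero (by omega)
    have : Fintype K := Fintype.ofFinite K
    have h := FiniteField.pow_card x
    rw [Fintype.card_eq_nat_card, hK] at h
    show (x ^ 3) ^ 3 = x
    rw [← pow_mul]
    exact h)

/-- The Zassenhaus group `M(3²)`: the permutations
`ω ↦ (a β(ω) + b) / (c β(ω) + d)` of `K ∪ {∞}` with `Δ = a d - b c ≠ 0`, where `β` is the identity
if `Δ` is a square in `K`, and `β(ω) = ω ^ 3`, `β(∞) = ∞` if `Δ` is not a square. (These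
permutations already form a group; `GL (Fin 2) K` acts on `OnePoint K` by Möbius
transformations.) -/
def zassenhaus {K : Type*} [Field K] [DecidableEq K] (hK : Nat.card K = 9) :
    Subgroup (Equiv.Perm (OnePoint K)) :=
  Subgroup.closure {h | ∃ A : GL (Fin 2) K,
    (IsSquare (A : Matrix (Fin 2) (Fin 2) K).det ∧ ∀ ω, h ω = A • ω) ∨
    (¬ IsSquare (A : Matrix (Fin 2) (Fin 2) K).det ∧
      ∀ ω, h ω = A • affinePerm (cubePerm hK) ω)}

/-! ### The twelve points and the distinguished permutations -/

/-- Two new points outside the projective line. -/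
inductive NewPoint
  | v
  | w
  deriving DecidableEq

/-- The set `K ∪ {∞} ∪ {v, w}`. -/
abbrev Points (K : Type*) := OnePoint K ⊕ NewPoint

/-- A permutation of `K ∪ {∞}`, extended so as to fix `v` and `w`. -/
def extend {K : Type*} (h : Equiv.Perm (OnePoint K)) : Equiv.Perm (Points K) :=
  Equiv.sumCongr h (Equiv.refl NewPoint)

/-- `a : ω ↦ ζ⁻¹ ω ^ 3`, fixing `∞`. -/
def permA {K : Type*} [Field K] (hK : Nat.card K = 9) (ζ : K) (hζ : ζ ^ 2 = 1 - ζ) :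
    Equiv.Perm (OnePoint K) :=
  affinePerm ((cubePerm hK).trans (Equiv.mulLeft₀ ζ⁻¹ (inv_ne_zero (by
    rintro rfl
    norm_num at hζ))))

/-- `T : ω ↦ 1 - ω`, fixing `∞`. -/
def permT {K : Type*} [Field K] : Equiv.Perm (OnePoint K) :=
  affinePerm (Equiv.subLeft 1)

/-- The map `ω ↦ ω⁻¹`, interchanging `0` and `∞`. -/
def invMap {K : Type*} [Field K] [DecidableEq K] (p : OnePoint K) : OnePoint K :=
  OnePoint.elim p ((0 : K) : OnePoint K) (fun x => if x = 0 then ∞ else ((x⁻¹ : K) : OnePoint K))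

/-- `J : ω ↦ ω⁻¹`, interchanging `0` and `∞`. -/
def permJ {K : Type*} [Field K] [DecidableEq K] : Equiv.Perm (OnePoint K) :=
  Function.Involutive.toPerm invMap (by
    intro p
    cases p with
    | infty => simp [invMap]
    | coe x => by_cases hx : x = 0 <;> simp [invMap, hx])

theorem three_eq_zero {K : Type*} [Field K] (hK : Nat.card K = 9) : (3 : K) = 0 := by
  have : Finite K := Nat.finite_of_card_ne_zero (by omega)
  have : Fintype K := Fintype.ofFinite K
  have h := FiniteField.cast_card_eq_zero K
  rw [Fintype.card_eq_nat_card, hK] at h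
  have h2 : (3 : K) ^ 2 = 0 := by
    rw [← h]
    norm_num
  exact pow_eq_zero_iff (two_ne_zero) |>.1 h2

/-- The permutation `α + ζ β ↦ α - ζ β` (for `α, β` in the prime field) of `K`, written as a
polynomial function of the element of `K`; see `conjPerm_apply`. -/
def conjPerm {K : Type*} [Field K] (hK : Nat.card K = 9) (ζ : K) (hζ : ζ ^ 2 = 1 - ζ) :
    Equiv.Perm K :=
  Function.Involutive.toPerm (fun x => (ζ - 1) * x - (1 + ζ) * x ^ 3) (by
    intro x
    have h3 := three_eq_zero hK
    have h9 : x ^ 9 = x := by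
      have h := (cubePerm hK).left_inv x
      change (x ^ 3) ^ 3 = x at h
      rw [← pow_mul] at h
      exact h
    show (ζ - 1) * ((ζ - 1) * x - (1 + ζ) * x ^ 3)
      - (1 + ζ) * ((ζ - 1) * x - (1 + ζ) * x ^ 3) ^ 3 = x
    have hcube : ((ζ - 1) * x - (1 + ζ) * x ^ 3) ^ 3
        = (ζ - 1) ^ 3 * x ^ 3 - (1 + ζ) ^ 3 * x ^ 9 := by
      linear_combination (-((ζ - 1) * x) ^ 2 * ((1 + ζ) * x ^ 3)
        + ((ζ - 1) * x) * ((1 + ζ) * x ^ 3) ^ 2) * h3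
    rw [hcube, h9]
    grind)

/-- The defining property of `conjPerm`; every element of `K` is `α + ζ β` with `α, β` in the
prime field, that is, with `α, β` images of integers. -/
theorem conjPerm_apply {K : Type*} [Field K] (hK : Nat.card K = 9) (ζ : K)
    (hζ : ζ ^ 2 = 1 - ζ) (α β : ℤ) :
    conjPerm hK ζ hζ (α + ζ * β) = α - ζ * β := by
  have h3 := three_eq_zero hK
  have hc : ∀ n : ℤ, (n : K) ^ 3 = n := by
    intro n
    obtain ⟨m, hm⟩ : ∃ m : ℤ, n = 3 * m ∨ n = 3 * m + 1 ∨ n = 3 * m + 2 := ⟨n / 3, by omega⟩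
    rcases hm with rfl | rfl | rfl <;> push_cast <;> rw [h3] <;> grind
  show (ζ - 1) * (α + ζ * β) - (1 + ζ) * (α + ζ * β : K) ^ 3 = α - ζ * β
  have hcube : (α + ζ * β : K) ^ 3 = α + ζ ^ 3 * β := by
    have h1 := hc α
    have h2 := hc β
    linear_combination h1 + ζ ^ 3 * h2 + ((α : K) ^ 2 * (ζ * β) + α * (ζ * β) ^ 2) * h3
  rw [hcube]
  grind

/-- The map interchanging `∞` and `v`, fixing `w`, and acting on `K` as `conjPerm`. -/
def conjMap {K : Type*} [Field K] (hK : Nat.card K = 9) (ζ : K) (hζ : ζ ^ 2 = 1 - ζ) :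
    Points K → Points K
  | Sum.inl p => OnePoint.elim p (Sum.inr NewPoint.v)
      (fun x => Sum.inl ((conjPerm hK ζ hζ x : K) : OnePoint K))
  | Sum.inr NewPoint.v => Sum.inl ∞
  | Sum.inr NewPoint.w => Sum.inr NewPoint.w

/-- `U = S₄`: it interchanges `∞` and `v`, fixes `w`, and maps `α + ζ β` to `α - ζ β` for `α, β`
in the prime field. -/
def permU {K : Type*} [Field K] (hK : Nat.card K = 9) (ζ : K) (hζ : ζ ^ 2 = 1 - ζ) :
    Equiv.Perm (Points K) :=
  Function.Involutive.toPerm (conjMap hK ζ hζ) (by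
    rintro (p | q)
    · cases p with
      | infty => rfl
      | coe x =>
        have hx : conjPerm hK ζ hζ (conjPerm hK ζ hζ x) = x := (conjPerm hK ζ hζ).left_inv x
        simp [conjMap, hx]
    · cases q <;> rfl)

/-- `V = S₅`: it interchanges `v` and `w`, fixes `∞`, and maps `ω ∈ K` to `ω ^ 3`. -/
def permV {K : Type*} [Field K] (hK : Nat.card K = 9) : Equiv.Perm (Points K) :=
  Equiv.sumCongr (affinePerm (cubePerm hK)) (Equiv.swap NewPoint.v NewPoint.w)

/-! ### The Mathieu groups `M₁₁` and `M₁₂` by Witt's construction -/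

/-- `M₁₁ = ⟨M(3²), S₄⟩`, as a group of permutations of the twelve points fixing `w`. -/
def M11 {K : Type*} [Field K] [DecidableEq K] (hK : Nat.card K = 9) (ζ : K)
    (hζ : ζ ^ 2 = 1 - ζ) : Subgroup (Equiv.Perm (Points K)) :=
  Subgroup.closure (extend '' (zassenhaus hK : Set (Equiv.Perm (OnePoint K))) ∪ {permU hK ζ hζ})

/-- `M₁₂ = ⟨M₁₁, S₅⟩`. -/
def M12 {K : Type*} [Field K] [DecidableEq K] (hK : Nat.card K = 9) (ζ : K)
    (hζ : ζ ^ 2 = 1 - ζ) : Subgroup (Equiv.Perm (Points K)) :=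
  Subgroup.closure ((M11 hK ζ hζ : Set (Equiv.Perm (Points K))) ∪ {permV hK})

/-! ### The presentation -/

/-- The generating symbols `a, T, J, U, V`. -/
inductive Gen
  | a
  | T
  | J
  | U
  | V

/-- The commutator `[x, y] = x y x⁻¹ y⁻¹`. -/
def comm {G : Type*} [Group G] (x y : G) : G := x * y * x⁻¹ * y⁻¹

/-- The conjugate `x ^ y = y⁻¹ x y`. -/
def conjBy {G : Type*} [Group G] (x y : G) : G := y⁻¹ * x * y

/-- The relators of `M(3²)`: `T² = J² = (JT)³ = (Ta²)³ = [J,a]⁴ = (J[J,a])² = 1`, `a² = [J,a]²`,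
`(aT)² = T ^ [J,a]`. A relation `x = y` is coded as the relator
`x y⁻¹`. -/
def relsM9 (a T J : FreeGroup Gen) : Set (FreeGroup Gen) :=
  {T ^ 2, J ^ 2, (J * T) ^ 3, (T * a ^ 2) ^ 3, (comm J a) ^ 4, (J * (comm J a)) ^ 2,
    a ^ 2 * ((comm J a) ^ 2)⁻¹, (a * T) ^ 2 * (conjBy T (comm J a))⁻¹}

/-- The relators of `M₁₁`: those of `M(3²)`, and
`U² = (UT)² = (UJ)³ = 1`, `a ^ U = [J,a]`. -/
def relsM11 (a T J U : FreeGroup Gen) : Set (FreeGroup Gen) :=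
  relsM9 a T J ∪ {U ^ 2, (U * T) ^ 2, (U * J) ^ 3, conjBy a U * (comm J a)⁻¹}

/-- The relators of `M₁₂`: those of `M₁₁`, and `V² = (VT)² = (VJ)² = (VU)³ = 1`,
`a ^ V = [J,a]⁻¹ a`, `[J,a] ^ V = [J,a]⁻¹`. -/
def relsM12 (a T J U V : FreeGroup Gen) : Set (FreeGroup Gen) :=
  relsM11 a T J U ∪ {V ^ 2, (V * T) ^ 2, (V * J) ^ 2, (V * U) ^ 3,
    conjBy a V * ((comm J a)⁻¹ * a)⁻¹, conjBy (comm J a) V * ((comm J a)⁻¹)⁻¹}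

/-- The abstract group with generating symbols `a, T, J, U, V` and the relators of `M₁₂`. -/
abbrev PresentedM12 : Type :=
  PresentedGroup (relsM12 (FreeGroup.of Gen.a) (FreeGroup.of Gen.T) (FreeGroup.of Gen.J)
    (FreeGroup.of Gen.U) (FreeGroup.of Gen.V))

end Mathieu

/-! The difficulty is that the relations suffice, that is, that the presented group acts faithfully
on the twelve points. They make the subgroup generated by `a` and `b = [J,a]` a quotient of the
quaternion group of order eight. Adjoining `T`, `J`, `U`, `V` in turn gives a tower in which every
step has the form `⟨H, n⟩ = H ∪ H n H`. For `T` this is checked on the quaternion elements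
(`T_conj_quaternion`). Each later involution normalizes the group two steps below the new one and
braids with the involution adjoined just before it, and this forces the double coset form
(`conj_mem_oneOrDouble_of_braid`).

In the permutation representation each level fixes a point moved by the next involution: `0`, `∞`,
`v`, `w` for `T`, `J`, `U`, `V`. Hence an element acting trivially falls through the tower into the
quaternion subgroup, where only the identity fixes the point `1` (`injective_of_points`). No group
order is computed.

That the relations hold is a finite check on a numbering of the points. That the image is all of
`M12` amounts to `a`, `T`, `J` generating M(3²): `mem_of_eq_smul` writes each of its elements as a
product of dilations, translations and at most one `J`. -/

namespace Mathieu

/-! ### Double cosets of an involution, for an arbitrary group. -/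

section Abstract

variable {G : Type*} [Group G]

/-- The set `H ∪ H n H`. -/
def oneOrDouble (H : Subgroup G) (n : G) : Set G :=
  {g | g ∈ H ∨ ∃ x ∈ H, ∃ y ∈ H, g = x * n * y}

theorem mul_mem_oneOrDouble {H : Subgroup G} {n x g : G} (hx : x ∈ H)
    (hg : g ∈ oneOrDouble H n) : x * g ∈ oneOrDouble H n := by
  rcases hg with hg | ⟨y, hy, z, hz, rfl⟩
  · exact Or.inl (H.mul_mem hx hg)
  · exact Or.inr ⟨x * y, H.mul_mem hx hy, z, hz, by group⟩

/-- If `n` is an involution and `n H n ⊆ H ∪ H n H`, then `⟨H, n⟩ = H ∪ H n H`. -/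
theorem closure_insert_subset_oneOrDouble {H : Subgroup G} {n : G} (hn : n * n = 1)
    (h : ∀ x ∈ H, n * x * n ∈ oneOrDouble H n) {g : G}
    (hg : g ∈ Subgroup.closure (insert n (H : Set G))) : g ∈ oneOrDouble H n := by
  have hninv : n⁻¹ = n := inv_eq_of_mul_eq_one_left hn
  have hnmul : ∀ y ∈ oneOrDouble H n, n * y ∈ oneOrDouble H n := by
    rintro y (hy | ⟨u, hu, v, hv, rfl⟩)
    · exact Or.inr ⟨1, H.one_mem, y, hy, by group⟩
    · have key := h u hu
      rcases key with hk | ⟨p, hp, q, hq, hk⟩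
      · exact Or.inl (by simpa only [mul_assoc] using H.mul_mem hk hv)
      · exact Or.inr ⟨p, hp, q * v, H.mul_mem hq hv, by
          rw [← mul_assoc, ← mul_assoc, hk]; group⟩
  induction hg using Subgroup.closure_induction_left with
  | one => exact Or.inl H.one_mem
  | mul_left x hx y hy ih =>
    rcases hx with rfl | hx
    · exact hnmul _ ih
    · exact mul_mem_oneOrDouble hx ih
  | inv_mul_cancel x hx y hy ih =>
    rcases hx with rfl | hx
    · rw [hninv]; exact hnmul _ ih
    · exact mul_mem_oneOrDouble (H.inv_mem hx) ih

/-- If `H = P ∪ P s P`, and the involution `n` normalizes `P` and braids with `s`, then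
`⟨H, n⟩ = H ∪ H n H`. -/
theorem conj_mem_oneOrDouble_of_braid {P H : Subgroup G} {s n : G}
    (hH : ∀ g ∈ H, g ∈ oneOrDouble P s) (hPH : P ≤ H) (hs : s ∈ H) (hn : n * n = 1)
    (hP : ∀ p ∈ P, n * p * n ∈ P) (hb : n * s * n = s * n * s) :
    ∀ x ∈ H, n * x * n ∈ oneOrDouble H n := by
  intro x hx
  rcases hH x hx with hx | ⟨p, hp, q, hq, rfl⟩
  · exact Or.inl (hPH (hP x hx))
  -- Conjugating factor by factor, `n p s q n = (n p n)(n s n)(n q n)`. The braid relation replaces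
  -- the middle factor by `s n s`, which leaves a single `n` between elements of `H`.
  · refine Or.inr ⟨n * p * n * s, H.mul_mem (hPH (hP p hp)) hs,
      s * (n * q * n), H.mul_mem hs (hPH (hP q hq)), ?_⟩
    have hninv : n⁻¹ = n := inv_eq_of_mul_eq_one_left hn
    calc n * (p * s * q) * n = n * p * (n * n) * s * (n * n) * q * n := by rw [hn]; group
      _ = n * p * n * (n * s * n) * n * q * n := by group
      _ = _ := by rw [hb]; group

theorem conj_mem_closure_of_forall {S : Set G} {n : G} (hn : n * n = 1)
    (h : ∀ s ∈ S, n * s * n ∈ Subgroup.closure S) :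
    ∀ p ∈ Subgroup.closure S, n * p * n ∈ Subgroup.closure S := by
  have hninv : n⁻¹ = n := inv_eq_of_mul_eq_one_left hn
  have hle : Subgroup.closure S ≤ (Subgroup.closure S).comap (MulAut.conj n).toMonoidHom := by
    rw [Subgroup.closure_le]
    intro s hs
    simpa [hninv] using h s hs
  intro p hp
  simpa [hninv] using hle hp

/-- A subgroup `H` fixing a point `x` moved by `n` is the stabilizer of `x` in `H ∪ H n H`. -/
theorem mem_of_mem_oneOrDouble_of_fixed {X : Type*} (φ : G →* Equiv.Perm X) {S : Set G} {n : G}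
    {x : X} (hS : ∀ s ∈ S, φ s x = x) (hn : φ n x ≠ x) {g : G}
    (hg : g ∈ oneOrDouble (Subgroup.closure S) n) (hgx : φ g x = x) :
    g ∈ Subgroup.closure S := by
  have hH : ∀ h ∈ Subgroup.closure S, φ h x = x := by
    have hle : Subgroup.closure S ≤ (MulAction.stabilizer (Equiv.Perm X) x).comap φ := by
      rw [Subgroup.closure_le]
      intro s hs
      exact hS s hs
    intro h hh
    exact hle hh
  rcases hg with hg | ⟨y, hy, z, hz, rfl⟩
  · exact hg
  · refine absurd ?_ hn
    rw [map_mul, map_mul, Equiv.Perm.mul_apply, Equiv.Perm.mul_apply, hH z hz] at hgx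
    exact (φ y).injective (hgx.trans (hH y hy).symm)

theorem insert_closure_closure (n : G) (S : Set G) :
    Subgroup.closure (insert n (Subgroup.closure S : Set G)) = Subgroup.closure (insert n S) := by
  rw [Set.insert_eq, Set.insert_eq, Subgroup.closure_union, Subgroup.closure_union,
    Subgroup.closure_eq]

/-- The relations of `M₁₂` between elements of a group, with `b` for `[J, a]`. -/
structure M12Relations (a b T J U V : G) : Prop where
  b_eq : b = J * a * J⁻¹ * a⁻¹
  T_sq : T * T = 1
  J_sq : J * J = 1
  JT : (J * T) ^ 3 = 1
  Ta : (T * a ^ 2) ^ 3 = 1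
  b_four : b ^ 4 = 1
  Jb : (J * b) ^ 2 = 1
  a_sq : a ^ 2 = b ^ 2
  aT : (a * T) ^ 2 = b⁻¹ * T * b
  U_sq : U * U = 1
  UT : (U * T) ^ 2 = 1
  UJ : (U * J) ^ 3 = 1
  aU : U⁻¹ * a * U = b
  V_sq : V * V = 1
  VT : (V * T) ^ 2 = 1
  VJ : (V * J) ^ 2 = 1
  VU : (V * U) ^ 3 = 1
  aV : V⁻¹ * a * V = b⁻¹ * a
  bV : V⁻¹ * b * V = b⁻¹

theorem braid_of_mul_pow_three {s n : G} (hs : s * s = 1) (hn : n * n = 1)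
    (h : (n * s) ^ 3 = 1) : n * s * n = s * n * s := by
  have hs' : s⁻¹ = s := inv_eq_of_mul_eq_one_left hs
  have hn' : n⁻¹ = n := inv_eq_of_mul_eq_one_left hn
  have h' : n * s * n * (s * n * s) = 1 := by rw [← h]; simp only [pow_succ, pow_zero]; group
  rw [mul_eq_one_iff_eq_inv.1 h']
  simp [hs', hn', mul_assoc]

theorem conj_eq_of_mul_sq {s n : G} (hs : s * s = 1) (h : (n * s) ^ 2 = 1) :
    n * s * n = s := by
  have hs' : s⁻¹ = s := inv_eq_of_mul_eq_one_left hs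
  have h' : n * s * n * s = 1 := by rw [← h, sq]; group
  rw [mul_eq_one_iff_eq_inv.1 h', hs']

theorem mul_mem_oneOrDouble_right {H : Subgroup G} {n x g : G} (hx : x ∈ H)
    (hg : g ∈ oneOrDouble H n) : g * x ∈ oneOrDouble H n := by
  rcases hg with hg | ⟨y, hy, z, hz, rfl⟩
  · exact Or.inl (H.mul_mem hg hx)
  · exact Or.inr ⟨y, hy, z * x, H.mul_mem hz hx, by group⟩

theorem inv_mem_oneOrDouble {H : Subgroup G} {n g : G} (hn : n * n = 1)
    (hg : g ∈ oneOrDouble H n) : g⁻¹ ∈ oneOrDouble H n := by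
  have hn' : n⁻¹ = n := inv_eq_of_mul_eq_one_left hn
  rcases hg with hg | ⟨y, hy, z, hz, rfl⟩
  · exact Or.inl (H.inv_mem hg)
  · exact Or.inr ⟨z⁻¹, H.inv_mem hz, y⁻¹, H.inv_mem hy, by simp [hn', mul_assoc]⟩

/-! ### Consequences of the relations: the quaternion subgroup and the tower above it. -/

namespace M12Relations

variable {a b T J U V : G}

theorem T_inv (R : M12Relations a b T J U V) : T⁻¹ = T := inv_eq_of_mul_eq_one_left R.T_sq

theorem J_conj_b (R : M12Relations a b T J U V) : J * b * J = b⁻¹ := by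
  have h : J * b * J * b = 1 := by rw [← R.Jb, sq]; group
  exact mul_eq_one_iff_eq_inv.1 h

theorem J_conj_a (R : M12Relations a b T J U V) : J * a * J = b * a := by
  have hJ : J⁻¹ = J := inv_eq_of_mul_eq_one_left R.J_sq
  rw [R.b_eq, hJ]; group

theorem a_four (R : M12Relations a b T J U V) : a ^ 4 = 1 := by
  rw [show (4 : ℕ) = 2 * 2 from rfl, pow_mul, R.a_sq, ← pow_mul, R.b_four]

/-- This is the quaternion relation: conjugating `a² = b²` by `J` gives `(ba)² = b⁻²`, and `b⁻² =
b²` because `b⁴ = 1`. -/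
theorem a_b_a (R : M12Relations a b T J U V) : a * b * a = b := by
  have h1 : (b * a) ^ 2 = (b ^ 2)⁻¹ := by
    calc (b * a) ^ 2 = J * a * (J * J) * a * J := by rw [← R.J_conj_a, sq]; group
      _ = J * a ^ 2 * J := by rw [R.J_sq, sq]; group
      _ = J * b * (J * J) * b * J := by rw [R.a_sq, R.J_sq, sq]; group
      _ = (J * b * J) * (J * b * J) := by group
      _ = _ := by rw [R.J_conj_b]; group
  have h2 : (b ^ 2)⁻¹ = b ^ 2 := inv_eq_of_mul_eq_one_left (by rw [← pow_add, R.b_four])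
  rw [h2, sq, sq] at h1
  have h3 : b * (a * b * a) = b * b := by rw [← h1]; group
  exact mul_left_cancel h3

theorem b_mul_a (R : M12Relations a b T J U V) : b * a = a⁻¹ * b := by
  rw [eq_inv_mul_iff_mul_eq, ← mul_assoc, R.a_b_a]

theorem b_inv (R : M12Relations a b T J U V) : b⁻¹ = a ^ 2 * b := by
  rw [R.a_sq, ← pow_succ]
  exact inv_eq_of_mul_eq_one_left (by rw [← pow_succ, R.b_four])

theorem exists_eq_of_mem_quaternion (R : M12Relations a b T J U V) {g : G}
    (hg : g ∈ Subgroup.closure {a, b}) : ∃ i : ℕ, i < 4 ∧ (g = a ^ i ∨ g = a ^ i * b) := by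
  have red : ∀ i : ℤ, ∃ j : ℕ, j < 4 ∧ a ^ i = a ^ j := by
    intro i
    refine ⟨(i % 4).toNat, by omega, ?_⟩
    have h := R.a_four
    rw [← zpow_natCast, Int.toNat_of_nonneg (by omega)]
    conv_lhs => rw [← Int.emod_add_mul_ediv i 4, zpow_add, zpow_mul]
    rw [show a ^ (4 : ℤ) = 1 by exact_mod_cast h, one_zpow, mul_one]
  -- With integer exponents the normal form is visibly stable under inverses; reduction modulo 4 is
  -- needed only once, at the end.
  suffices h : ∃ i : ℤ, g = a ^ i ∨ g = a ^ i * b by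
    obtain ⟨i, hi⟩ := h
    obtain ⟨j, hj, hij⟩ := red i
    exact ⟨j, hj, hij ▸ hi⟩
  have hba : ∀ i : ℤ, b * a ^ i = a ^ (-i) * b := by
    intro i
    have h : SemiconjBy b a a⁻¹ := R.b_mul_a
    have h' := h.zpow_right i
    rw [SemiconjBy, inv_zpow'] at h'
    exact h'
  have hbb : b * b = a ^ (2 : ℤ) := by
    rw [← sq, ← R.a_sq]; norm_cast
  have hbi : b⁻¹ = a ^ (2 : ℤ) * b := by
    rw [R.b_inv]; norm_cast
  have hb : ∀ y : G, (∃ i : ℤ, y = a ^ i ∨ y = a ^ i * b) →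
      ∃ i : ℤ, b * y = a ^ i ∨ b * y = a ^ i * b := by
    rintro y ⟨i, rfl | rfl⟩
    · exact ⟨-i, Or.inr (hba i)⟩
    · exact ⟨-i + 2, Or.inl (by rw [← mul_assoc, hba, mul_assoc, hbb, zpow_add])⟩
  have ha : ∀ (k : ℤ) (y : G), (∃ i : ℤ, y = a ^ i ∨ y = a ^ i * b) →
      ∃ i : ℤ, a ^ k * y = a ^ i ∨ a ^ k * y = a ^ i * b := by
    rintro k y ⟨i, rfl | rfl⟩
    · exact ⟨k + i, Or.inl (zpow_add a k i).symm⟩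
    · exact ⟨k + i, Or.inr (by rw [zpow_add, mul_assoc])⟩
  induction hg using Subgroup.closure_induction_left with
  | one => exact ⟨0, Or.inl (zpow_zero a).symm⟩
  | mul_left x hx y hy ih =>
    rcases hx with rfl | rfl
    · simpa using ha 1 y ih
    · exact hb y ih
  | inv_mul_cancel x hx y hy ih =>
    rcases hx with rfl | rfl
    · simpa using ha (-1) y ih
    · rw [hbi, mul_assoc]; exact ha 2 _ (hb y ih)

theorem T_conj_a (R : M12Relations a b T J U V) : T * a * T = a⁻¹ * b⁻¹ * T * b := by
  have h : a * (T * a * T) = b⁻¹ * T * b := by rw [← R.aT, sq]; group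
  rw [← eq_inv_mul_iff_mul_eq] at h
  rw [h]; group

theorem T_conj_a_sq (R : M12Relations a b T J U V) : T * a ^ 2 * T = a ^ 2 * T * a ^ 2 := by
  refine (braid_of_mul_pow_three ?_ R.T_sq R.Ta)
  rw [← pow_add, R.a_four]

theorem T_conj_b (R : M12Relations a b T J U V) : T * b * T = b * a * T * a := by
  calc T * b * T = b * (b⁻¹ * T * b) * T := by group
    _ = b * a * T * a * (T * T) := by rw [← R.aT, sq]; group
    _ = _ := by rw [R.T_sq, mul_one]

/-- `H ∪ H T H` is closed under inverses, so among the eight normal forms only `a`, `a²`, `b` and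
`ab` need work. The first three are rewritten by the relations for `(aT)²` and `(Ta²)³`. Multiplying
the formulas for `TaT` and `TbT` reduces `ab` to `a⁻¹`. -/
theorem T_conj_quaternion (R : M12Relations a b T J U V) :
    ∀ q ∈ Subgroup.closure {a, b}, T * q * T ∈ oneOrDouble (Subgroup.closure {a, b}) T := by
  have ma : a ∈ Subgroup.closure {a, b} := Subgroup.subset_closure (by simp)
  have mb : b ∈ Subgroup.closure {a, b} := Subgroup.subset_closure (by simp)
  have mT : T ∈ oneOrDouble (Subgroup.closure {a, b}) T :=
    Or.inr ⟨1, Subgroup.one_mem _, 1, Subgroup.one_mem _, by group⟩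
  have inv : ∀ q : G, T * q * T ∈ oneOrDouble (Subgroup.closure {a, b}) T →
      T * q⁻¹ * T ∈ oneOrDouble (Subgroup.closure {a, b}) T := by
    intro q h
    have h' := inv_mem_oneOrDouble R.T_sq h
    simpa [R.T_inv, mul_assoc] using h'
  have h1 : T * a * T ∈ oneOrDouble (Subgroup.closure {a, b}) T := by
    rw [R.T_conj_a]
    exact mul_mem_oneOrDouble_right mb (mul_mem_oneOrDouble
      (Subgroup.mul_mem _ (Subgroup.inv_mem _ ma) (Subgroup.inv_mem _ mb)) mT)
  have h2 : T * b * T ∈ oneOrDouble (Subgroup.closure {a, b}) T := by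
    rw [R.T_conj_b]
    exact mul_mem_oneOrDouble_right ma (mul_mem_oneOrDouble (Subgroup.mul_mem _ mb ma) mT)
  have h3 : T * a ^ 2 * T ∈ oneOrDouble (Subgroup.closure {a, b}) T := by
    rw [R.T_conj_a_sq]
    exact mul_mem_oneOrDouble_right (Subgroup.pow_mem _ ma 2)
      (mul_mem_oneOrDouble (Subgroup.pow_mem _ ma 2) mT)
  have h4 : T * (a * b) * T ∈ oneOrDouble (Subgroup.closure {a, b}) T := by
    have e : T * (a * b) * T = a⁻¹ * b⁻¹ * (T * a⁻¹ * T) * a := by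
      have hb2 : b * b * a = a⁻¹ := by
        rw [← sq, ← R.a_sq, ← pow_succ]
        exact eq_inv_of_mul_eq_one_left (by rw [← pow_succ, R.a_four])
      calc T * (a * b) * T = (T * a * T) * (T⁻¹ * b * T) := by group
        _ = a⁻¹ * b⁻¹ * (T * (b * b * a) * T) * a := by
          rw [R.T_inv, R.T_conj_b, R.T_conj_a]; group
        _ = _ := by rw [hb2]
    rw [e]
    exact mul_mem_oneOrDouble_right ma (mul_mem_oneOrDouble
      (Subgroup.mul_mem _ (Subgroup.inv_mem _ ma) (Subgroup.inv_mem _ mb)) (inv _ h1))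
  have a3 : a ^ 3 = a⁻¹ := eq_inv_of_mul_eq_one_left (by rw [← pow_succ, R.a_four])
  intro q hq
  obtain ⟨i, hi, rfl | rfl⟩ := R.exists_eq_of_mem_quaternion hq
  · interval_cases i
    · rw [pow_zero, mul_one, R.T_sq]; exact Or.inl (Subgroup.one_mem _)
    · rwa [pow_one]
    · exact h3
    · rw [a3]; exact inv _ h1
  · interval_cases i
    · rwa [pow_zero, one_mul]
    · rwa [pow_one]
    · rw [← R.b_inv]; exact inv _ h2
    · have : a ^ 3 * b = (a * b)⁻¹ := by
        rw [mul_inv_rev, R.b_inv, a3, eq_mul_inv_iff_mul_eq, mul_assoc, R.b_mul_a, ← mul_assoc,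
          ← a3, ← pow_add, show 3 + 3 = 4 + 2 from rfl, pow_add, R.a_four, one_mul]
      rw [this]; exact inv _ h4

/-- An action on a set with points `p1, p0, pinf, pv, pw`, on which the generators act as on the
points `1, 0, ∞, v, w`, is faithful. -/
theorem injective_of_points (R : M12Relations a b T J U V)
    (hG : Subgroup.closure {V, U, J, T, a, b} = ⊤)
    {X : Type*} (φ : G →* Equiv.Perm X) {p1 p0 pinf pv pw : X}
    (h1 : ∀ i < 4, φ (a ^ i) p1 = p1 → i = 0) (h1' : ∀ i < 4, φ (a ^ i * b) p1 ≠ p1)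
    (h0 : ∀ s ∈ ({a, b} : Set G), φ s p0 = p0) (hT : φ T p0 ≠ p0)
    (hinf : ∀ s ∈ ({T, a, b} : Set G), φ s pinf = pinf) (hJ : φ J pinf ≠ pinf)
    (hv : ∀ s ∈ ({J, T, a, b} : Set G), φ s pv = pv) (hU : φ U pv ≠ pv)
    (hw : ∀ s ∈ ({U, J, T, a, b} : Set G), φ s pw = pw) (hV : φ V pw ≠ pw) :
    Function.Injective φ := by
  have hUinv : U⁻¹ = U := inv_eq_of_mul_eq_one_left R.U_sq
  have hVinv : V⁻¹ = V := inv_eq_of_mul_eq_one_left R.V_sq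
  -- The levels of the tower. `J` normalizes `⟨a, b⟩` and braids with `T`; `U` normalizes `⟨T, a,
  -- b⟩`, interchanging `a` and `b`, and braids with `J`; `V` normalizes `⟨J, T, a, b⟩` and braids
  -- with `U`.
  have DT : ∀ g ∈ Subgroup.closure {T, a, b}, g ∈ oneOrDouble (Subgroup.closure {a, b}) T := by
    intro g hg
    rw [← insert_closure_closure] at hg
    exact closure_insert_subset_oneOrDouble R.T_sq R.T_conj_quaternion hg
  have DJ : ∀ g ∈ Subgroup.closure {J, T, a, b},
      g ∈ oneOrDouble (Subgroup.closure {T, a, b}) J := by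
    intro g hg
    rw [← insert_closure_closure] at hg
    refine closure_insert_subset_oneOrDouble R.J_sq (conj_mem_oneOrDouble_of_braid DT
      (Subgroup.closure_mono (Set.subset_insert _ _)) (Subgroup.subset_closure (by simp)) R.J_sq
      (conj_mem_closure_of_forall R.J_sq ?_)
      (braid_of_mul_pow_three R.T_sq R.J_sq R.JT)) hg
    have ma : a ∈ Subgroup.closure {a, b} := Subgroup.subset_closure (by simp)
    have mb : b ∈ Subgroup.closure {a, b} := Subgroup.subset_closure (by simp)
    rintro s (rfl | rfl)
    · rw [R.J_conj_a]; exact Subgroup.mul_mem _ mb ma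
    · rw [R.J_conj_b]; exact Subgroup.inv_mem _ mb
  have DU : ∀ g ∈ Subgroup.closure {U, J, T, a, b},
      g ∈ oneOrDouble (Subgroup.closure {J, T, a, b}) U := by
    intro g hg
    rw [← insert_closure_closure] at hg
    refine closure_insert_subset_oneOrDouble R.U_sq (conj_mem_oneOrDouble_of_braid DJ
      (Subgroup.closure_mono (Set.subset_insert _ _)) (Subgroup.subset_closure (by simp)) R.U_sq
      (conj_mem_closure_of_forall R.U_sq ?_)
      (braid_of_mul_pow_three R.J_sq R.U_sq R.UJ)) hg
    have hUa : U * a * U = b := by rw [← R.aU, hUinv]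
    rintro s (rfl | rfl | rfl)
    · rw [conj_eq_of_mul_sq R.T_sq R.UT]; exact Subgroup.subset_closure (by simp)
    · rw [hUa]; exact Subgroup.subset_closure (by simp)
    · have : U * s * U = a := by
        calc U * s * U = (U * U) * a * (U * U) := by rw [← hUa]; group
          _ = a := by rw [R.U_sq]; group
      rw [this]; exact Subgroup.subset_closure (by simp)
  have DV : ∀ g : G, g ∈ oneOrDouble (Subgroup.closure {U, J, T, a, b}) V := by
    intro g
    have hg : g ∈ Subgroup.closure {V, U, J, T, a, b} := hG ▸ Subgroup.mem_top g
    rw [← insert_closure_closure] at hg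
    refine closure_insert_subset_oneOrDouble R.V_sq (conj_mem_oneOrDouble_of_braid DU
      (Subgroup.closure_mono (Set.subset_insert _ _)) (Subgroup.subset_closure (by simp)) R.V_sq
      (conj_mem_closure_of_forall R.V_sq ?_)
      (braid_of_mul_pow_three R.U_sq R.V_sq R.VU)) hg
    have ma : a ∈ Subgroup.closure {J, T, a, b} := Subgroup.subset_closure (by simp)
    have mb : b ∈ Subgroup.closure {J, T, a, b} := Subgroup.subset_closure (by simp)
    rintro s (rfl | rfl | rfl | rfl)
    · rw [conj_eq_of_mul_sq R.J_sq R.VJ]; exact Subgroup.subset_closure (by simp)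
    · rw [conj_eq_of_mul_sq R.T_sq R.VT]; exact Subgroup.subset_closure (by simp)
    · have h := R.aV
      rw [hVinv] at h
      rw [h]; exact Subgroup.mul_mem _ (Subgroup.inv_mem _ mb) ma
    · have h := R.bV
      rw [hVinv] at h
      rw [h]; exact Subgroup.inv_mem _ mb
  rw [injective_iff_map_eq_one]
  intro g hg
  have fix : ∀ x, φ g x = x := fun x => by rw [hg]; rfl
  -- Read from the inside out: fixing `pw`, `pv`, `pinf`, `p0` removes `V`, `U`, `J`, `T` in turn.
  have gQ := mem_of_mem_oneOrDouble_of_fixed φ h0 hT (DT g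
    (mem_of_mem_oneOrDouble_of_fixed φ hinf hJ (DJ g
      (mem_of_mem_oneOrDouble_of_fixed φ hv hU (DU g
        (mem_of_mem_oneOrDouble_of_fixed φ hw hV (DV g) (fix pw))) (fix pv))) (fix pinf)))
    (fix p0)
  obtain ⟨i, hi, rfl | rfl⟩ := R.exists_eq_of_mem_quaternion gQ
  · rw [h1 i hi (fix p1), pow_zero]
  · exact absurd (fix p1) (h1' i hi)

end M12Relations
end Abstract
end Mathieu

namespace Mathieu

section Tables

/-! ### The generators as permutations of twelve numbered points

The numbers `0, …, 7` stand for the powers of `ζ`, and `8, 9, 10, 11` for `0, ∞, v, w`. -/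

/-- On exponents of `ζ` modulo 8, `tableA`, `tableJ` and `tableV` are `k ↦ 3k - 1`, `-k` and `3k`.
`tableT` and `tableU` depend on addition, through `ζ² = 1 - ζ`, `ζ³ = -1 - ζ`, `ζ⁴ = -1` and their
negatives. -/
def tableA : Equiv.Perm (Fin 12) where
  toFun := ![7, 2, 5, 0, 3, 6, 1, 4, 8, 9, 10, 11]
  invFun := ![3, 6, 1, 4, 7, 2, 5, 0, 8, 9, 10, 11]
  left_inv := by decide
  right_inv := by decide

def tableT : Equiv.Perm (Fin 12) :=
  Function.Involutive.toPerm ![8, 2, 1, 6, 4, 7, 3, 5, 0, 9, 10, 11] (by unfold Function.Involutive; decide)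

def tableJ : Equiv.Perm (Fin 12) :=
  Function.Involutive.toPerm ![0, 7, 6, 5, 4, 3, 2, 1, 9, 8, 10, 11] (by unfold Function.Involutive; decide)

def tableU : Equiv.Perm (Fin 12) :=
  Function.Involutive.toPerm ![0, 5, 7, 6, 4, 1, 3, 2, 8, 10, 9, 11] (by unfold Function.Involutive; decide)

def tableV : Equiv.Perm (Fin 12) :=
  Function.Involutive.toPerm ![0, 3, 6, 1, 4, 7, 2, 5, 8, 9, 11, 10] (by unfold Function.Involutive; decide)

/-- The numbered permutation of each generating symbol. -/
def table : Gen → Equiv.Perm (Fin 12)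
  | .a => tableA
  | .T => tableT
  | .J => tableJ
  | .U => tableU
  | .V => tableV

theorem lift_table_eq_one : ∀ r ∈ relsM12 (FreeGroup.of Gen.a) (FreeGroup.of Gen.T)
    (FreeGroup.of Gen.J) (FreeGroup.of Gen.U) (FreeGroup.of Gen.V),
    FreeGroup.lift table r = 1 := by
  intro r hr
  simp only [relsM12, relsM11, relsM9, Set.mem_union, Set.mem_insert_iff,
    Set.mem_singleton_iff] at hr
  rcases hr with ((h | h | h | h | h | h | h | h) | h | h | h | h) | h | h | h | h | h | h <;>
  · subst h
    simp only [comm, conjBy, map_mul, map_pow, map_inv, FreeGroup.lift_apply_of, table]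
    ext i
    revert i
    decide

/-- The action of the abstract group on twelve numbered points. -/
def tableHom : PresentedM12 →* Equiv.Perm (Fin 12) :=
  PresentedGroup.toGroup lift_table_eq_one

theorem tableHom_of (g : Gen) : tableHom (PresentedGroup.of g) = table g :=
  PresentedGroup.toGroup.of lift_table_eq_one

theorem m12Relations_of_forall_map_eq_one {G : Type*} [Group G] (f : FreeGroup Gen →* G)
    (a T J U V : FreeGroup Gen) (h : ∀ r ∈ relsM12 a T J U V, f r = 1) :
    M12Relations (f a) (comm (f J) (f a)) (f T) (f J) (f U) (f V) := by
  simp only [relsM12, relsM11, relsM9, Set.union_insert, Set.union_singleton,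
    Set.forall_mem_insert, Set.mem_singleton_iff, forall_eq, comm, conjBy,
    map_mul, map_pow, map_inv, mul_inv_eq_one] at h
  -- `Set.union_insert` moves the right-hand set of each union to the front, so the relators of `V`
  -- come first and those of M(3²) last.
  obtain ⟨V2, VT, VJ, VU, aV, bV, U2, UT, UJ, aU, T2, J2, JT, Ta, b4, Jb, a2, aT⟩ := h
  rw [sq] at V2 U2 T2 J2
  exact ⟨rfl, T2, J2, JT, Ta, b4, Jb, a2, aT, U2, UT, UJ, aU, V2, VT, VJ, VU, aV, bV⟩

theorem presented_relations :
    M12Relations (G := PresentedM12) (PresentedGroup.of .a)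
      (comm (PresentedGroup.of .J) (PresentedGroup.of .a)) (PresentedGroup.of .T)
      (PresentedGroup.of .J) (PresentedGroup.of .U) (PresentedGroup.of .V) :=
  m12Relations_of_forall_map_eq_one (PresentedGroup.mk _) _ _ _ _ _
    fun _ hr => PresentedGroup.one_of_mem hr

theorem tableHom_injective : Function.Injective tableHom := by
  refine presented_relations.injective_of_points ?_ tableHom
    (p1 := 0) (p0 := 8) (pinf := 9) (pv := 10) (pw := 11) ?_ ?_ ?_ ?_ ?_ ?_ ?_ ?_ ?_ ?_
  · rw [eq_top_iff, ← PresentedGroup.closure_range_of, Subgroup.closure_le]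
    rintro _ ⟨g, rfl⟩
    apply Subgroup.subset_closure
    cases g <;> simp
  all_goals simp only [comm, Set.mem_insert_iff, Set.mem_singleton_iff, forall_eq_or_imp, forall_eq,
    map_mul, map_inv, map_pow, tableHom_of, table]
  all_goals decide

end Tables
end Mathieu

namespace Mathieu

section Transfer

/-! ### Numbering the twelve points -/

variable {K : Type*}

theorem extend_inl (h : Equiv.Perm (OnePoint K)) (p : OnePoint K) :
    extend h (.inl p) = .inl (h p) := rfl

theorem inl_coe_congr {x y : K} (h : x = y) :
    (Sum.inl (x : OnePoint K) : Points K) = Sum.inl (y : OnePoint K) := h ▸ rfl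

theorem card_newPoint : Nat.card NewPoint = 2 := by
  let e : NewPoint ≃ Bool :=
    ⟨fun p => p.casesOn true false, fun b => if b then .v else .w,
      by rintro (_ | _) <;> rfl, by rintro (_ | _) <;> rfl⟩
  rw [Nat.card_congr e, Nat.card_eq_fintype_card, Fintype.card_bool]

theorem card_points (hK : Nat.card K = 9) : Nat.card (Points K) = 12 := by
  have : Finite K := Nat.finite_of_card_ne_zero (by omega)
  have : Finite NewPoint := Nat.finite_of_card_ne_zero (by rw [card_newPoint]; omega)
  have : Finite (OnePoint K) := inferInstanceAs (Finite (Option K))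
  rw [Nat.card_sum, card_newPoint]
  have h : Nat.card (OnePoint K) = Nat.card K + 1 := Finite.card_option
  rw [h, hK]

/-! ### Arithmetic of the field with nine elements, and the numbering of the points. -/

variable [Field K]

theorem zeta_mul (ζ : K) (hζ : ζ ^ 2 = 1 - ζ) : ζ * (1 + ζ) = 1 := by
  linear_combination hζ

theorem zeta_ne_zero (ζ : K) (hζ : ζ ^ 2 = 1 - ζ) : ζ ≠ 0 :=
  left_ne_zero_of_mul_eq_one (zeta_mul ζ hζ)

theorem zeta_inv (ζ : K) (hζ : ζ ^ 2 = 1 - ζ) : ζ⁻¹ = 1 + ζ :=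
  inv_eq_of_mul_eq_one_right (zeta_mul ζ hζ)

theorem pow_nine (hK : Nat.card K = 9) (x : K) : x ^ 9 = x := by
  have h := (cubePerm hK).left_inv x
  change (x ^ 3) ^ 3 = x at h
  rwa [← pow_mul] at h

theorem two_ne_zero_of_card (hK : Nat.card K = 9) : (2 : K) ≠ 0 := by
  intro h
  have h3 := three_eq_zero hK
  exact one_ne_zero (α := K) (by linear_combination h3 - h)

/-- The nonzero elements of `K` are the first eight powers of `ζ`. -/
theorem eq_zero_or_eq_pow (hK : Nat.card K = 9) (ζ : K) (hζ : ζ ^ 2 = 1 - ζ) (x : K) :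
    x = 0 ∨ x = 1 ∨ x = ζ ∨ x = 1 - ζ ∨ x = -1 - ζ ∨ x = -1 ∨ x = -ζ ∨ x = ζ - 1 ∨
      x = 1 + ζ := by
  have h3 := three_eq_zero hK
  -- The product is `x⁹ - x`: pairing each factor with that of the opposite root gives `x(x² - 1)(x²
  -- + 1)(x⁴ + 1)`.
  have h : x * ((x - 1) * ((x - ζ) * ((x - (1 - ζ)) * ((x - (-1 - ζ)) * ((x - (-1)) *
      ((x - (-ζ)) * ((x - (ζ - 1)) * (x - (1 + ζ))))))))) = 0 := by
    have h9 := pow_nine hK x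
    have e1 : (x - ζ) * (x - (-ζ)) = x ^ 2 - 1 + ζ := by linear_combination -hζ
    have e2 : (x - (1 - ζ)) * (x - (ζ - 1)) = x ^ 2 + 1 := by
      linear_combination -hζ + h3 * (ζ - 1)
    have e3 : (x - (-1 - ζ)) * (x - (1 + ζ)) = x ^ 2 - ζ + 1 := by
      linear_combination -hζ - h3
    have e4 : (x ^ 2 - 1 + ζ) * (x ^ 2 - ζ + 1) = x ^ 4 + 1 := by
      linear_combination -hζ + h3 * (ζ - 1)
    calc _ = x * (x ^ 2 - 1) * ((x - (1 - ζ)) * (x - (ζ - 1))) *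
        (((x - ζ) * (x - (-ζ))) * ((x - (-1 - ζ)) * (x - (1 + ζ)))) := by ring
      _ = x ^ 9 - x := by rw [e1, e2, e3, e4]; ring
      _ = 0 := sub_eq_zero.2 h9
  simpa only [mul_eq_zero, sub_eq_zero] using h

/-- The numbering of the twelve points. -/
def point (ζ : K) : Fin 12 → Points K :=
  ![.inl ((1 : K) : OnePoint K), .inl (ζ : OnePoint K), .inl ((1 - ζ : K) : OnePoint K),
    .inl ((-1 - ζ : K) : OnePoint K), .inl ((-1 : K) : OnePoint K), .inl ((-ζ : K) : OnePoint K),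
    .inl ((ζ - 1 : K) : OnePoint K), .inl ((1 + ζ : K) : OnePoint K), .inl ((0 : K) : OnePoint K),
    .inl ∞, .inr .v, .inr .w]

theorem point_surjective (hK : Nat.card K = 9) (ζ : K) (hζ : ζ ^ 2 = 1 - ζ) :
    Function.Surjective (point ζ) := by
  rintro ((_ | x) | (_ | _))
  · exact ⟨9, rfl⟩
  · rcases eq_zero_or_eq_pow hK ζ hζ x with h | h | h | h | h | h | h | h | h <;> rw [h]
    exacts [⟨8, rfl⟩, ⟨0, rfl⟩, ⟨1, rfl⟩, ⟨2, rfl⟩, ⟨3, rfl⟩, ⟨4, rfl⟩, ⟨5, rfl⟩, ⟨6, rfl⟩,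
      ⟨7, rfl⟩]
  · exact ⟨10, rfl⟩
  · exact ⟨11, rfl⟩

/-- The numbering of the twelve points, as a bijection. -/
noncomputable def pointEquiv (hK : Nat.card K = 9) (ζ : K) (hζ : ζ ^ 2 = 1 - ζ) :
    Fin 12 ≃ Points K :=
  Equiv.ofBijective (point ζ) <| by
    have : Finite (Points K) := Nat.finite_of_card_ne_zero (by rw [card_points hK]; omega)
    -- Surjectivity between sets of twelve elements suffices, so the listed field elements need not
    -- be shown distinct.
    exact (point_surjective hK ζ hζ).bijective_of_nat_card_le (by simp [card_points hK])

/-- The permutation of the twelve points denoted by a generating symbol. -/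
def perm [DecidableEq K] (hK : Nat.card K = 9) (ζ : K) (hζ : ζ ^ 2 = 1 - ζ) :
    Gen → Equiv.Perm (Points K)
  | .a => extend (permA hK ζ hζ)
  | .T => extend permT
  | .J => extend permJ
  | .U => permU hK ζ hζ
  | .V => permV hK

theorem permJ_coe [DecidableEq K] {x y : K} (h : x * y = 1) :
    permJ (x : OnePoint K) = (y : OnePoint K) := by
  change (if x = 0 then ∞ else ((x⁻¹ : K) : OnePoint K)) = y
  rw [if_neg (left_ne_zero_of_mul_eq_one h), inv_eq_of_mul_eq_one_right h]

/-- With `ζ⁻¹` replaced by `1 + ζ`, each case in `K` is a polynomial identity modulo `ζ² = 1 - ζ`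
and `3 = 0`; the three other points are definitional. -/
theorem perm_a_point [DecidableEq K] (hK : Nat.card K = 9) (ζ : K) (hζ : ζ ^ 2 = 1 - ζ)
    (i : Fin 12) : extend (permA hK ζ hζ) (point ζ i) = point ζ (tableA i) := by
  have h3 := three_eq_zero hK
  have key : ∀ x y : K, (1 + ζ) * x ^ 3 = y →
      extend (permA hK ζ hζ) (.inl (x : OnePoint K)) = .inl (y : OnePoint K) := by
    intro x y h
    refine inl_coe_congr ?_
    change ζ⁻¹ * x ^ 3 = y
    rw [zeta_inv ζ hζ, h]
  fin_cases i
  iterate 9 refine key _ _ ?_; grind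
  all_goals rfl

theorem perm_T_point (ζ : K) (hK : Nat.card K = 9) (i : Fin 12) :
    extend permT (point ζ i) = point ζ (tableT i) := by
  have h3 := three_eq_zero hK
  have key : ∀ x y : K, 1 - x = y →
      extend permT (.inl (x : OnePoint K)) = .inl (y : OnePoint K) := by
    intro x y h
    exact inl_coe_congr h
  fin_cases i
  iterate 9 refine key _ _ ?_; grind
  all_goals rfl

theorem perm_J_point [DecidableEq K] (hK : Nat.card K = 9) (ζ : K) (hζ : ζ ^ 2 = 1 - ζ)
    (i : Fin 12) : extend permJ (point ζ i) = point ζ (tableJ i) := by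
  have h3 := three_eq_zero hK
  have key : ∀ x y : K, x * y = 1 →
      extend permJ (.inl (x : OnePoint K)) = .inl (y : OnePoint K) := by
    intro x y h
    rw [extend_inl, permJ_coe h]
  fin_cases i
  iterate 8 refine key _ _ ?_; grind
  · change (Sum.inl (if (0 : K) = 0 then ∞ else _) : Points K) = _
    rw [if_pos rfl]; rfl
  all_goals rfl

theorem perm_U_point (hK : Nat.card K = 9) (ζ : K) (hζ : ζ ^ 2 = 1 - ζ)
    (i : Fin 12) : permU hK ζ hζ (point ζ i) = point ζ (tableU i) := by
  have h3 := three_eq_zero hK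
  have key : ∀ x y : K, (ζ - 1) * x - (1 + ζ) * x ^ 3 = y →
      permU hK ζ hζ (.inl (x : OnePoint K)) = .inl (y : OnePoint K) := by
    intro x y h
    exact inl_coe_congr h
  fin_cases i
  iterate 9 refine key _ _ ?_; grind
  all_goals rfl

theorem perm_V_point (hK : Nat.card K = 9) (ζ : K) (hζ : ζ ^ 2 = 1 - ζ)
    (i : Fin 12) : permV hK (point ζ i) = point ζ (tableV i) := by
  have h3 := three_eq_zero hK
  have key : ∀ x y : K, x ^ 3 = y →
      permV hK (.inl (x : OnePoint K)) = .inl (y : OnePoint K) := by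
    intro x y h
    exact inl_coe_congr h
  fin_cases i
  iterate 9 refine key _ _ ?_; grind
  all_goals rfl

theorem permCongr_table [DecidableEq K] (hK : Nat.card K = 9) (ζ : K) (hζ : ζ ^ 2 = 1 - ζ)
    (g : Gen) : (pointEquiv hK ζ hζ).permCongr (table g) = perm hK ζ hζ g := by
  ext p
  obtain ⟨i, rfl⟩ := (pointEquiv hK ζ hζ).surjective p
  rw [Equiv.permCongr_apply, Equiv.symm_apply_apply]
  symm
  cases g
  · exact perm_a_point hK ζ hζ i
  · exact perm_T_point ζ hK i
  · exact perm_J_point hK ζ hζ i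
  · exact perm_U_point hK ζ hζ i
  · exact perm_V_point hK ζ hζ i

/-- The permutation representation of the abstract group on the twelve points. -/
noncomputable def permHom (hK : Nat.card K = 9) (ζ : K) (hζ : ζ ^ 2 = 1 - ζ) :
    PresentedM12 →* Equiv.Perm (Points K) :=
  (pointEquiv hK ζ hζ).permCongrHom.toMonoidHom.comp tableHom

theorem permHom_injective (hK : Nat.card K = 9) (ζ : K) (hζ : ζ ^ 2 = 1 - ζ) :
    Function.Injective (permHom hK ζ hζ) :=
  (pointEquiv hK ζ hζ).permCongrHom.injective.comp tableHom_injective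

theorem permHom_of [DecidableEq K] (hK : Nat.card K = 9) (ζ : K) (hζ : ζ ^ 2 = 1 - ζ) (g : Gen) :
    permHom hK ζ hζ (PresentedGroup.of g) = perm hK ζ hζ g := by
  rw [← permCongr_table, ← tableHom_of]; rfl

theorem range_permHom [DecidableEq K] (hK : Nat.card K = 9) (ζ : K) (hζ : ζ ^ 2 = 1 - ζ) :
    (permHom hK ζ hζ).range = Subgroup.closure (Set.range (perm hK ζ hζ)) := by
  rw [MonoidHom.range_eq_map, ← PresentedGroup.closure_range_of, MonoidHom.map_closure,
    ← Set.range_comp]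
  congr 2
  ext1 g
  exact permHom_of hK ζ hζ g

end Transfer
end Mathieu

namespace Mathieu

section Zassenhaus

/-! ### Generators of `M(3²)` -/

variable {K : Type*}

/-- Some element of `S` fixes `∞` and acts on `K` as `f`. -/
def ActsIn (S : Subgroup (Equiv.Perm (OnePoint K))) (f : K → K) : Prop :=
  ∃ g ∈ S, g ∞ = ∞ ∧ ∀ x : K, g (x : OnePoint K) = ((f x : K) : OnePoint K)

theorem ActsIn.comp {S : Subgroup (Equiv.Perm (OnePoint K))} {f₁ f₂ : K → K}
    (h₁ : ActsIn S f₁) (h₂ : ActsIn S f₂) : ActsIn S (fun x => f₁ (f₂ x)) := by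
  obtain ⟨g₁, m₁, i₁, e₁⟩ := h₁
  obtain ⟨g₂, m₂, i₂, e₂⟩ := h₂
  refine ⟨g₁ * g₂, S.mul_mem m₁ m₂, ?_, fun x => ?_⟩
  · rw [Equiv.Perm.mul_apply, i₂, i₁]
  · rw [Equiv.Perm.mul_apply, e₂, e₁]

theorem ActsIn.of_leftInverse {S : Subgroup (Equiv.Perm (OnePoint K))} {f f' : K → K}
    (h : ActsIn S f) (hf : ∀ x, f (f' x) = x) : ActsIn S f' := by
  obtain ⟨g, m, i, e⟩ := h
  refine ⟨g⁻¹, S.inv_mem m, ?_, fun x => ?_⟩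
  · rw [Equiv.Perm.inv_eq_iff_eq, i]
  · rw [Equiv.Perm.inv_eq_iff_eq, e, hf]

variable [Field K]

/-- The cubing automorphism of a field with nine elements. -/
def cubeHom (hK : Nat.card K = 9) : K →+* K where
  toFun x := x ^ 3
  map_one' := one_pow 3
  map_mul' x y := mul_pow x y 3
  map_zero' := zero_pow (by norm_num)
  map_add' x y := by linear_combination (x ^ 2 * y + x * y ^ 2) * three_eq_zero hK

/-- The automorphism `θ` is trivial if `c` is a square, and cubing otherwise. -/
def IsTwist (hK : Nat.card K = 9) (c : K) (θ : K →+* K) : Prop :=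
  IsSquare c ∧ θ = RingHom.id K ∨ ¬ IsSquare c ∧ θ = cubeHom hK

theorem IsTwist.involutive {hK : Nat.card K = 9} {c : K} {θ : K →+* K} (h : IsTwist hK c θ)
    (x : K) : θ (θ x) = x := by
  rcases h with ⟨-, rfl⟩ | ⟨-, rfl⟩
  · rfl
  · exact (cubePerm hK).left_inv x

theorem exists_isTwist (hK : Nat.card K = 9) (c : K) : ∃ θ, IsTwist hK c θ := by
  by_cases h : IsSquare c
  · exact ⟨_, Or.inl ⟨h, rfl⟩⟩
  · exact ⟨_, Or.inr ⟨h, rfl⟩⟩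

/-- The twist sees only the class modulo nonzero squares, so a determinant may be exchanged for the
dilation factor of the corresponding map. -/
theorem IsTwist.mul_sq {hK : Nat.card K = 9} {c e c' : K} {θ : K →+* K} (h : IsTwist hK c θ)
    (he : e ≠ 0) (hc : c' = c * e ^ 2) : IsTwist hK c' θ := by
  subst hc
  have key : IsSquare (c * e ^ 2) ↔ IsSquare c := by
    refine ⟨?_, fun h => h.mul ⟨e, sq e⟩⟩
    rintro ⟨d, hd⟩
    exact ⟨d / e, by field_simp; rw [hd, sq]⟩
  rwa [IsTwist, key]

theorem exists_eq_pow (hK : Nat.card K = 9) (ζ : K) (hζ : ζ ^ 2 = 1 - ζ) {x : K} (hx : x ≠ 0) :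
    ∃ k : ℕ, x = ζ ^ k := by
  have h3 := three_eq_zero hK
  have e3 : ζ ^ 3 = -1 - ζ := by grind
  have e4 : ζ ^ 4 = -1 := by grind
  have e5 : ζ ^ 5 = -ζ := by grind
  have e6 : ζ ^ 6 = ζ - 1 := by grind
  have e7 : ζ ^ 7 = 1 + ζ := by grind
  rcases eq_zero_or_eq_pow hK ζ hζ x with h | h | h | h | h | h | h | h | h
  exacts [absurd h hx, ⟨0, by simpa using h⟩, ⟨1, by simpa using h⟩, ⟨2, h.trans hζ.symm⟩,
    ⟨3, h.trans e3.symm⟩, ⟨4, h.trans e4.symm⟩, ⟨5, h.trans e5.symm⟩, ⟨6, h.trans e6.symm⟩,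
    ⟨7, h.trans e7.symm⟩]

theorem neg_one_eq_sq (hK : Nat.card K = 9) (ζ : K) (hζ : ζ ^ 2 = 1 - ζ) :
    (-1 : K) = (ζ ^ 2) ^ 2 := by
  have h3 := three_eq_zero hK
  grind

/-- A square root `d` would give `ζ⁻⁴ = d⁸ = 1`, whereas `ζ⁴ = -1`. -/
theorem not_isSquare_zeta_inv (hK : Nat.card K = 9) (ζ : K) (hζ : ζ ^ 2 = 1 - ζ) :
    ¬ IsSquare ζ⁻¹ := by
  rintro ⟨d, hd⟩
  have h3 := three_eq_zero hK
  have hd0 : d ≠ 0 := by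
    rintro rfl
    exact inv_ne_zero (zeta_ne_zero ζ hζ) (by simpa using hd)
  have h8 : d ^ 8 = 1 := by
    refine mul_left_cancel₀ hd0 ?_
    rw [← pow_succ', pow_nine hK, mul_one]
  have h1 : (ζ⁻¹) ^ 4 = 1 := by rw [hd, ← h8]; ring
  have h2 : ζ ^ 4 = 1 := by
    have h := congrArg Inv.inv h1
    simpa using h
  have h4 := neg_one_eq_sq hK ζ hζ
  exact two_ne_zero_of_card hK (by linear_combination -h2 - h4)

variable [DecidableEq K] {hK : Nat.card K = 9} {ζ : K} {hζ : ζ ^ 2 = 1 - ζ}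
  {S : Subgroup (Equiv.Perm (OnePoint K))}

theorem permJ_zero : permJ ((0 : K) : OnePoint K) = ∞ := by
  change (if (0 : K) = 0 then ∞ else _) = ∞
  rw [if_pos rfl]

theorem permJ_infty : permJ (∞ : OnePoint K) = ((0 : K) : OnePoint K) := rfl

/-- The commutator `[J,a]` is multiplication by `ζ²`: `JaJ` acts on `K` as `x ↦ ζx³`, and `a⁻¹` as
`x ↦ ζ³x³`. -/
theorem actsIn_mul_pow (hA : permA hK ζ hζ ∈ S) (hJ : permJ ∈ S) (k : ℕ) :
    ActsIn S (fun x => ζ ^ (2 * k) * x) := by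
  have h0 := zeta_ne_zero ζ hζ
  have a_acts : ActsIn S (fun x => ζ⁻¹ * x ^ 3) := ⟨_, hA, rfl, fun _ => rfl⟩
  have a_conj : ActsIn S (fun x => ζ * x ^ 3) := by
    refine ⟨permJ * permA hK ζ hζ * permJ, S.mul_mem (S.mul_mem hJ hA) hJ, ?_, fun x => ?_⟩
    · rw [Equiv.Perm.mul_apply, Equiv.Perm.mul_apply, permJ_infty]
      change permJ (((ζ⁻¹ * 0 ^ 3 : K)) : OnePoint K) = ∞
      rw [zero_pow (by norm_num), mul_zero, permJ_zero]
    · rw [Equiv.Perm.mul_apply, Equiv.Perm.mul_apply]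
      by_cases hx : x = 0
      · subst hx
        rw [permJ_zero]
        change permJ ∞ = ((ζ * 0 ^ 3 : K) : OnePoint K)
        rw [zero_pow (by norm_num), mul_zero, permJ_infty]
      · rw [permJ_coe (mul_inv_cancel₀ hx)]
        change permJ (((ζ⁻¹ * x⁻¹ ^ 3 : K)) : OnePoint K) = _
        exact permJ_coe (by field_simp)
  have b_acts : ActsIn S (fun x => ζ ^ 2 * x) := by
    have h := a_conj.comp (a_acts.of_leftInverse (f' := fun x => ζ ^ 3 * x ^ 3) fun x => by
      have h9 := pow_nine hK x
      have h8 : ζ ^ 8 = 1 := mul_left_cancel₀ h0 (by rw [← pow_succ', pow_nine hK, mul_one])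
      field_simp
      linear_combination x ^ 9 * h8 + h9)
    convert h using 2 with x
    have h9 := pow_nine hK x
    have h8 := pow_nine hK ζ
    linear_combination -ζ * x ^ 9 * h8 - ζ ^ 2 * h9
  induction k with
  | zero => exact ⟨1, S.one_mem, rfl, fun x => by simp⟩
  | succ k ih =>
    convert b_acts.comp ih using 2 with x
    ring

/-- Squares are even powers of `ζ`. A nonsquare is `ζ ^ (2j+1) = ζ ^ (2(j+1)) · ζ⁻¹`, and the factor
`ζ⁻¹` together with the cubing is supplied by `a`. -/
theorem actsIn_mul_twist (hA : permA hK ζ hζ ∈ S) (hJ : permJ ∈ S) {c : K} (hc : c ≠ 0)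
    {θ : K →+* K} (h : IsTwist hK c θ) : ActsIn S (fun x => c * θ x) := by
  rcases h with ⟨⟨d, rfl⟩, rfl⟩ | ⟨hns, rfl⟩
  · obtain ⟨k, rfl⟩ := exists_eq_pow hK ζ hζ (left_ne_zero_of_mul hc)
    convert actsIn_mul_pow hA hJ k using 2 with x
    rw [RingHom.id_apply]; ring
  · obtain ⟨k, rfl⟩ := exists_eq_pow hK ζ hζ hc
    rcases Nat.even_or_odd' k with ⟨j, rfl | rfl⟩
    · exact absurd ⟨ζ ^ j, by ring⟩ hns
    · have a_acts : ActsIn S (fun x => ζ⁻¹ * x ^ 3) := ⟨_, hA, rfl, fun _ => rfl⟩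
      convert (actsIn_mul_pow hA hJ (j + 1)).comp a_acts using 2 with x
      have h0 := zeta_ne_zero ζ hζ
      change ζ ^ (2 * j + 1) * x ^ 3 = _
      rw [show 2 * (j + 1) = (2 * j + 1) + 1 from by ring, pow_succ ζ (2 * j + 1), mul_assoc,
        mul_inv_cancel_left₀ h0]

/-- `T` after negation is translation by `1`; conjugating it by `x ↦ c θ(x)`, with `θ` the twist
belonging to `c`, gives translation by `c`. -/
theorem actsIn_add (hA : permA hK ζ hζ ∈ S) (hT : permT ∈ S) (hJ : permJ ∈ S) (c : K) :
    ActsIn S (fun x => x + c) := by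
  by_cases hc : c = 0
  · exact ⟨1, S.one_mem, rfl, fun x => by simp [hc]⟩
  have T_acts : ActsIn S (fun x => 1 - x) := ⟨_, hT, rfl, fun _ => rfl⟩
  have neg : ActsIn S (fun x => -1 * RingHom.id K x) :=
    actsIn_mul_twist hA hJ (neg_ne_zero.2 one_ne_zero)
      (Or.inl ⟨⟨ζ ^ 2, by rw [neg_one_eq_sq hK ζ hζ, sq]⟩, rfl⟩)
  obtain ⟨θ, hθ⟩ := exists_isTwist hK c
  have dil := actsIn_mul_twist hA hJ hc hθ
  have dil_inv := dil.of_leftInverse (f' := fun x => θ (c⁻¹ * x)) fun x => by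
    rw [hθ.involutive, mul_inv_cancel_left₀ hc]
  convert dil.comp (T_acts.comp (neg.comp dil_inv)) using 2 with x
  rw [RingHom.id_apply, map_sub, map_one, map_mul, map_neg, map_one, hθ.involutive]
  field_simp
  ring

/-- Every generator of `M(3²)` lies in each group that contains `a`, `T` and `J`. -/
theorem mem_of_eq_smul (hA : permA hK ζ hζ ∈ S) (hT : permT ∈ S) (hJ : permJ ∈ S)
    {A : GL (Fin 2) K} {θ : K →+* K} (hθ : IsTwist hK (A : Matrix (Fin 2) (Fin 2) K).det θ)
    {h : Equiv.Perm (OnePoint K)} (hinf : h ∞ = A • (∞ : OnePoint K))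
    (hcoe : ∀ x : K, h x = A • ((θ x : K) : OnePoint K)) : h ∈ S := by
  have hdet := A.det_ne_zero
  rw [Matrix.det_fin_two] at hθ hdet
  rw [OnePoint.smul_infty_eq_ite] at hinf
  simp only [OnePoint.smul_some_eq_ite] at hcoe
  generalize (A : Matrix (Fin 2) (Fin 2) K) 0 0 = p at *
  generalize (A : Matrix (Fin 2) (Fin 2) K) 0 1 = q at *
  generalize (A : Matrix (Fin 2) (Fin 2) K) 1 0 = r at *
  generalize (A : Matrix (Fin 2) (Fin 2) K) 1 1 = s at *
  by_cases hr : r = 0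
  · subst hr
    rw [mul_zero, sub_zero] at hθ hdet
    have hp := left_ne_zero_of_mul hdet
    have hs := right_ne_zero_of_mul hdet
    obtain ⟨g, hg, gi, gx⟩ := (actsIn_add hA hT hJ (q / s)).comp
      (actsIn_mul_twist hA hJ (div_ne_zero hp hs)
        (hθ.mul_sq (c' := p / s) (inv_ne_zero hs) (by field_simp)))
    convert hg
    ext ω
    cases ω with
    | infty => rw [gi, hinf, if_pos rfl]
    | coe x =>
      rw [gx, hcoe, zero_mul, zero_add, if_neg hs]
      congr 1
      field_simp
  -- Bruhat decomposition: with `y = θ(x)` and `Δ = ps - qr`, `(py + q)/(ry + s) = p/r - (Δ/r²)/(y +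
  -- s/r)`, and `y + s/r = θ(x + θ(s/r))` since `θ` is an involution. The factor `-Δ/r²` has the
  -- same twist as `Δ` because `-1 = (ζ²)²`.
  · have hc : -(p * s - q * r) / r ^ 2 ≠ 0 := div_ne_zero (neg_ne_zero.2 hdet) (pow_ne_zero 2 hr)
    have hζ0 := zeta_ne_zero ζ hζ
    obtain ⟨g, hg, gi, gx⟩ := (actsIn_add hA hT hJ (p / r)).comp
      (actsIn_mul_twist hA hJ hc
        (hθ.mul_sq (e := ζ ^ 2 / r) (div_ne_zero (pow_ne_zero 2 hζ0) hr) (by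
          rw [div_pow, ← neg_one_eq_sq hK ζ hζ]; ring)))
    obtain ⟨t, ht, ti, tx⟩ := actsIn_add hA hT hJ (θ (s / r))
    beta_reduce at gx tx
    convert S.mul_mem (S.mul_mem hg hJ) ht
    ext ω
    cases ω with
    | infty =>
      rw [Equiv.Perm.mul_apply, Equiv.Perm.mul_apply, ti, permJ_infty, gx, hinf, if_neg hr,
        map_zero, mul_zero, zero_add]
    | coe x =>
      have hu : r * θ x + s = r * θ (x + θ (s / r)) := by
        rw [map_add, hθ.involutive]; field_simp
      rw [Equiv.Perm.mul_apply, Equiv.Perm.mul_apply, tx, hcoe]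
      by_cases hz : x + θ (s / r) = 0
      · rw [hz, permJ_zero, gi, if_pos (by rw [hu, hz, map_zero, mul_zero])]
      · have hz' : θ (x + θ (s / r)) ≠ 0 := (map_ne_zero θ).2 hz
        have hd : r * θ x + s ≠ 0 := by rw [hu]; exact mul_ne_zero hr hz'
        rw [permJ_coe (mul_inv_cancel₀ hz), gx, if_neg hd, map_inv₀]
        congr 1
        have : θ (x + θ (s / r)) = (r * θ x + s) / r := by
          rw [hu]; field_simp
        rw [this, inv_div]
        generalize θ x = y at hd ⊢
        -- Eliminating `s` turns the denominator into a single variable `d`, known to be nonzero.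
        obtain ⟨d, rfl⟩ : ∃ d, s = d - r * y := ⟨r * y + s, by ring⟩
        rw [add_sub_cancel] at hd ⊢
        field_simp
        ring

/-- The group `M(3²)` lies in every group that contains `a`, `T` and `J`. -/
theorem zassenhaus_le (hA : permA hK ζ hζ ∈ S) (hT : permT ∈ S) (hJ : permJ ∈ S) :
    zassenhaus hK ≤ S := by
  rw [zassenhaus, Subgroup.closure_le]
  rintro h ⟨A, ⟨hs, hh⟩ | ⟨hs, hh⟩⟩
  · exact mem_of_eq_smul hA hT hJ (Or.inl ⟨hs, rfl⟩) (hh _) fun x => hh x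
  · exact mem_of_eq_smul hA hT hJ (Or.inr ⟨hs, rfl⟩) (hh _) fun x => hh x

/-! ### The converse inclusion, and the generation of `M12`. -/

theorem permA_mem_zassenhaus (hK : Nat.card K = 9) (ζ : K) (hζ : ζ ^ 2 = 1 - ζ) :
    permA hK ζ hζ ∈ zassenhaus hK := by
  have hdet : (!![ζ⁻¹, 0; 0, 1] : Matrix (Fin 2) (Fin 2) K).det = ζ⁻¹ := by
    simp [Matrix.det_fin_two]
  refine Subgroup.subset_closure ⟨Matrix.GeneralLinearGroup.mkOfDetNeZero !![ζ⁻¹, 0; 0, 1]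
    (by rw [hdet]; exact inv_ne_zero (zeta_ne_zero ζ hζ)), Or.inr ⟨?_, fun ω => ?_⟩⟩
  · change ¬ IsSquare (!![ζ⁻¹, 0; 0, 1] : Matrix (Fin 2) (Fin 2) K).det
    rw [hdet]; exact not_isSquare_zeta_inv hK ζ hζ
  · cases ω with
    | infty =>
      change ∞ = _ • (∞ : OnePoint K)
      simp [OnePoint.smul_infty_eq_ite, Matrix.GeneralLinearGroup.mkOfDetNeZero]
    | coe x =>
      change ((ζ⁻¹ * x ^ 3 : K) : OnePoint K) = _ • ((x ^ 3 : K) : OnePoint K)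
      simp [OnePoint.smul_some_eq_ite, Matrix.GeneralLinearGroup.mkOfDetNeZero]

theorem permT_mem_zassenhaus (hK : Nat.card K = 9) (ζ : K) (hζ : ζ ^ 2 = 1 - ζ) :
    permT ∈ zassenhaus (K := K) hK := by
  have hdet : (!![-1, 1; 0, 1] : Matrix (Fin 2) (Fin 2) K).det = -1 := by
    simp [Matrix.det_fin_two]
  refine Subgroup.subset_closure ⟨Matrix.GeneralLinearGroup.mkOfDetNeZero !![-1, 1; 0, 1]
    (by rw [hdet]; exact neg_ne_zero.2 one_ne_zero), Or.inl ⟨?_, fun ω => ?_⟩⟩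
  · change IsSquare (!![-1, 1; 0, 1] : Matrix (Fin 2) (Fin 2) K).det
    rw [hdet, neg_one_eq_sq hK ζ hζ]; exact ⟨_, sq _⟩
  · cases ω with
    | infty =>
      change ∞ = _ • (∞ : OnePoint K)
      simp [OnePoint.smul_infty_eq_ite, Matrix.GeneralLinearGroup.mkOfDetNeZero]
    | coe x =>
      change ((1 - x : K) : OnePoint K) = _ • (x : OnePoint K)
      simp [OnePoint.smul_some_eq_ite, Matrix.GeneralLinearGroup.mkOfDetNeZero]
      ring

theorem permJ_mem_zassenhaus (hK : Nat.card K = 9) (ζ : K) (hζ : ζ ^ 2 = 1 - ζ) :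
    permJ ∈ zassenhaus (K := K) hK := by
  have hdet : (!![0, 1; 1, 0] : Matrix (Fin 2) (Fin 2) K).det = -1 := by
    simp [Matrix.det_fin_two]
  refine Subgroup.subset_closure ⟨Matrix.GeneralLinearGroup.mkOfDetNeZero !![0, 1; 1, 0]
    (by rw [hdet]; exact neg_ne_zero.2 one_ne_zero), Or.inl ⟨?_, fun ω => ?_⟩⟩
  · change IsSquare (!![0, 1; 1, 0] : Matrix (Fin 2) (Fin 2) K).det
    rw [hdet, neg_one_eq_sq hK ζ hζ]; exact ⟨_, sq _⟩
  · cases ω with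
    | infty =>
      rw [permJ_infty]
      simp [OnePoint.smul_infty_eq_ite, Matrix.GeneralLinearGroup.mkOfDetNeZero]
    | coe x =>
      change (if x = 0 then ∞ else ((x⁻¹ : K) : OnePoint K)) = _
      simp [OnePoint.smul_some_eq_ite, Matrix.GeneralLinearGroup.mkOfDetNeZero]

/-- Extension of permutations by the identity on `{v, w}`, as a homomorphism. -/
def extendHom (K : Type*) : Equiv.Perm (OnePoint K) →* Equiv.Perm (Points K) where
  toFun := extend
  map_one' := by ext (_ | _) <;> rfl
  map_mul' _ _ := by ext (_ | _) <;> rfl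

theorem M12_eq_closure (hK : Nat.card K = 9) (ζ : K) (hζ : ζ ^ 2 = 1 - ζ) :
    M12 hK ζ hζ = Subgroup.closure (Set.range (perm hK ζ hζ)) := by
  have hmem : ∀ g, perm hK ζ hζ g ∈ Subgroup.closure (Set.range (perm hK ζ hζ)) :=
    fun g => Subgroup.subset_closure ⟨g, rfl⟩
  apply le_antisymm
  · rw [M12, Subgroup.closure_le]
    refine Set.union_subset ?_ (Set.singleton_subset_iff.2 (hmem .V))
    change M11 hK ζ hζ ≤ _
    rw [M11, Subgroup.closure_le]
    refine Set.union_subset ?_ (Set.singleton_subset_iff.2 (hmem .U))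
    rw [Set.image_subset_iff]
    -- Pulling back along `extendHom` turns the claim into one about permutations of the projective
    -- line, where M(3²) lives.
    exact zassenhaus_le (S := (Subgroup.closure (Set.range (perm hK ζ hζ))).comap (extendHom K))
      (hmem .a) (hmem .T) (hmem .J)
  · rw [Subgroup.closure_le]
    have h11 : ∀ x ∈ M11 hK ζ hζ, x ∈ M12 hK ζ hζ :=
      fun x hx => Subgroup.subset_closure (Or.inl hx)
    have hz : ∀ x ∈ zassenhaus hK, extend x ∈ M12 hK ζ hζ :=
      fun x hx => h11 _ (Subgroup.subset_closure (Or.inl ⟨x, hx, rfl⟩))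
    rintro _ ⟨g, rfl⟩
    cases g
    · exact hz _ (permA_mem_zassenhaus hK ζ hζ)
    · exact hz _ (permT_mem_zassenhaus hK ζ hζ)
    · exact hz _ (permJ_mem_zassenhaus hK ζ hζ)
    · exact h11 _ (Subgroup.subset_closure (Or.inr rfl))
    · exact Subgroup.subset_closure (Or.inr rfl)

/-- The presented group is isomorphic to `M₁₂`, with the symbols mapped to the permutations of
the same name. -/
noncomputable def presentedEquiv (hK : Nat.card K = 9) (ζ : K) (hζ : ζ ^ 2 = 1 - ζ) :
    PresentedM12 ≃* M12 hK ζ hζ :=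
  (MonoidHom.ofInjective (permHom_injective hK ζ hζ)).trans
    (MulEquiv.subgroupCongr ((range_permHom hK ζ hζ).trans (M12_eq_closure hK ζ hζ).symm))

end Zassenhaus
end Mathieu

theorem proposition7p4 {K : Type*} [Field K] [DecidableEq K] (hK : Nat.card K = 9) (ζ : K)
    (hζ : ζ ^ 2 = 1 - ζ) :
    ∃ e : Mathieu.PresentedM12 ≃* Mathieu.M12 hK ζ hζ,
      (e (PresentedGroup.of Mathieu.Gen.a) : Equiv.Perm (Mathieu.Points K)) =
        Mathieu.extend (Mathieu.permA hK ζ hζ) ∧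
      (e (PresentedGroup.of Mathieu.Gen.T) : Equiv.Perm (Mathieu.Points K)) =
        Mathieu.extend Mathieu.permT ∧
      (e (PresentedGroup.of Mathieu.Gen.J) : Equiv.Perm (Mathieu.Points K)) =
        Mathieu.extend Mathieu.permJ ∧
      (e (PresentedGroup.of Mathieu.Gen.U) : Equiv.Perm (Mathieu.Points K)) =
        Mathieu.permU hK ζ hζ ∧
      (e (PresentedGroup.of Mathieu.Gen.V) : Equiv.Perm (Mathieu.Points K)) =
        Mathieu.permV hK :=
  ⟨Mathieu.presentedEquiv hK ζ hζ, Mathieu.permHom_of hK ζ hζ .a, Mathieu.permHom_of hK ζ hζ .T,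
    Mathieu.permHom_of hK ζ hζ .J, Mathieu.permHom_of hK ζ hζ .U, Mathieu.permHom_of hK ζ hζ .V⟩
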